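/- Let $p$ be an odd prime, let $m,s$ be positive integers, and let $\mathcal R=\mathbb F_{p^m}[u,v]/\langle u^2,v^2,uv-vu\rangle$. Let $\alpha=\alpha_1+\alpha_2u+\alpha_3v+\alpha_4uv\in\mathcal R$ with $\alpha_1,\alpha_2,\alpha_3,\alpha_4\in\mathbb F_{p^m}$, $\alpha_1\neq 0$ and $\alpha_3\ne 0$. Write $s=q_0m+r_0$ with integers $q_0\ge 0$ and $0\le r_0\le m-1$, and put $\alpha_0=\alpha_1^{p^{(q_0+1)m-s}}$, so that $\alpha_0^{p^s}=\alpha_1$. Identify a word $(c_0,\dots,c_{n-1})\in\mathcal R^n$ of length $n=2p^s$ with the class of $c_0+c_1x+\cdots+c_{n-1}x^{n-1}$ in $\mathcal R[x]/\langle x^{2p^s}-\alpha\rangle$. For $0\le \ell\le 2p^s-1$ let $\mathcal C=\langle u(x^2-\alpha_0)^\ell\rangle$ be the ideal of $\mathcal R[x]/\langle x^{2p^s}-\alpha\rangle$ generated by $u(x^2-\alpha_0)^\ell$, regarded as a code of length $n$ over $\mathcal R$. For words $x,y$ of length $n$ let $d_{sp}(x,y)=|\{i:(x_i,x_{i+1})\ne(y_i,y_{i+1})\}|$,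 with indices modulo $n$, and let $d_{sp}(\mathcal C)$ be the minimum of $d_{sp}(x,y)$ over all $x\neq y$ in $\mathcal C$. Then $$d_{sp}(\mathcal C)=\begin{cases}2 & \text{if } 0\le \ell\le p^s,\\ 2(\Gamma+1)p^\gamma & \text{if } 2p^s-p^{s-\gamma}+(\Gamma-1)p^{s-\gamma-1}+1\le \ell\le 2p^s-p^{s-\gamma}+\Gamma p^{s-\gamma-1},\\ & \text{where } 1\le\Gamma\le p-1 \text{ and } 0\le\gamma\le s-1.\end{cases}$$ -/

import Mathlib

open Polynomial

noncomputable section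

namespace SymbolPair

/-- The defining ideal `⟨u², v², uv - vu⟩` of `F[u, v]`, where `u = X 0` and `v = X 1`. -/
def relIdeal (F : Type*) [Field F] : Ideal (MvPolynomial (Fin 2) F) :=
  Ideal.span {MvPolynomial.X 0 ^ 2, MvPolynomial.X 1 ^ 2,
    MvPolynomial.X 0 * MvPolynomial.X 1 - MvPolynomial.X 1 * MvPolynomial.X 0}

/-- The ring `𝓡 = F[u, v] / ⟨u², v², uv - vu⟩ = F + uF + vF + uvF`. -/
abbrev RingR (F : Type*) [Field F] : Type _ := MvPolynomial (Fin 2) F ⧸ relIdeal F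

/-- The class of `u` in `𝓡`. -/
def u (F : Type*) [Field F] : RingR F := Ideal.Quotient.mk (relIdeal F) (MvPolynomial.X 0)

/-- The class of `v` in `𝓡`. -/
def v (F : Type*) [Field F] : RingR F := Ideal.Quotient.mk (relIdeal F) (MvPolynomial.X 1)

/-- The embedding of the constants `F` into `𝓡`. -/
def const {F : Type*} [Field F] (a : F) : RingR F := algebraMap F (RingR F) a

/-- The element `α₁ + α₂ u + α₃ v + α₄ uv` of `𝓡`. -/
def elemR {F : Type*} [Field F] (a₁ a₂ a₃ a₄ : F) : RingR F :=
  const a₁ + const a₂ * u F + const a₃ * v F + const a₄ * (u F * v F)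

/-- `α₀ = α₁ ^ (p ^ ((q₀ + 1) m - s))`, where `q₀ = ⌊s / m⌋` is the quotient in the division
`s = q₀ m + r₀`, `0 ≤ r₀ ≤ m - 1`. When `F` has `p ^ m` elements, `α₀ ^ (p ^ s) = α₁`. -/
def alphaZero {F : Type*} [Field F] (p m s : ℕ) (a₁ : F) : F :=
  a₁ ^ (p ^ ((s / m + 1) * m - s))

/-- The polynomial representation `c₀ + c₁ x + ⋯ + c_{n-1} x^{n-1}` of a word of length `n`. -/
def wordPoly {R : Type*} [CommRing R] {n : ℕ} (c : Fin n → R) : R[X] :=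
  ∑ i : Fin n, C (c i) * X ^ (i : ℕ)

/-- The ambient ring `R[x] / ⟨x^n - a⟩` of the `a`-constacyclic codes of length `n` over `R`. -/
abbrev Ambient (R : Type*) [CommRing R] (n : ℕ) (a : R) : Type _ :=
  AdjoinRoot (X ^ n - C a : R[X])

/-- The set of codewords in `Rⁿ` of an ideal of `R[x] / ⟨x^n - a⟩`: the words whose polynomial
representation lies in the ideal. -/
def codewords {R : Type*} [CommRing R] {n : ℕ} {a : R} (I : Ideal (Ambient R n a)) :
    Set (Fin n → R) :=
  {c | AdjoinRoot.mk (X ^ n - C a : R[X]) (wordPoly c) ∈ I}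

/-- The ideal `⟨u (x² - α₀)^ℓ⟩` of `𝓡[x] / ⟨x^n - α⟩`. -/
def typeB {F : Type*} [Field F] (n : ℕ) (α : RingR F) (α₀ : F) (ℓ : ℕ) :
    Ideal (Ambient (RingR F) n α) :=
  Ideal.span {AdjoinRoot.mk (X ^ n - C α : (RingR F)[X]) (C (u F) * (X ^ 2 - C (const α₀)) ^ ℓ)}

/-- The symbol-pair distance of two words: the number of indices `i` with
`(xᵢ, xᵢ₊₁) ≠ (yᵢ, yᵢ₊₁)`, where `i + 1` is read modulo `n` (`finRotate n` is `i ↦ i + 1`). -/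
def pairDist {A : Type*} {n : ℕ} (x y : Fin n → A) : ℕ :=
  Set.ncard {i : Fin n | (x i, x (finRotate n i)) ≠ (y i, y (finRotate n i))}

/-- The symbol-pair distance of a code: the minimum of the symbol-pair distances of two distinct
codewords. It is `0` for a code without two distinct words, and only for such a code. -/
def codePairDist {A : Type*} {n : ℕ} (𝒞 : Set (Fin n → A)) : ℕ :=
  sInf {d : ℕ | ∃ x ∈ 𝒞, ∃ y ∈ 𝒞, x ≠ y ∧ pairDist x y = d}

end SymbolPair

end

/-! Put N = p^s and n = 2N. Frobenius gives (x² - α₀)^N = xⁿ - α₁. Since u² = 0, modulo xⁿ - α one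
gets u(x² - α₀)^N = u(α - α₁) = α₃uv, and α₃ is a unit. Hence for ℓ ≤ N the code contains the word
with the single nonzero entry uv, of pair distance 2 from zero, while for even n distinct words
always differ in at least two pairs.

For ℓ = N + i with i ≤ N the generator is uv(x² - α₀)^i up to a unit. As u and v annihilate uv, the
code is uv times the code over F of the multiples of (x² - α₀)^i of degree below n
(`mem_codewords_typeB_iff`). Split such a multiple into its even and odd parts, read as polynomials
in x²: each is divisible by (x - α₀)^i and has degree below N. Positions of equal parity are never
cyclically adjacent, so the pair weight is at least twice the number of terms of a nonzero part. The
even word (x² - α₀)^T, with T the upper end of the range of i, attains the bound.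

What remains is to count terms: in characteristic p a nonzero root of multiplicity t forces at least
∏(tⱼ + 1) terms, tⱼ being the base-p digits of t (`digitWeight_le_card_support`), and
`le_digitWeight` minimizes this product over the admissible t. -/

noncomputable section

namespace SymbolPair

/-! ### Sections of a polynomial along residue classes, and counting of terms -/

/-- The `j`-th section `∑ₙ f_{np+j} Xⁿ` of a polynomial `f` along the residue classes mod `p`. -/
def sect {R : Type*} [CommRing R] (p j : ℕ) (f : R[X]) : R[X] :=
  ∑ n ∈ Finset.range (f.natDegree + 1), monomial n (f.coeff (n * p + j))

theorem coeff_sect {R : Type*} [CommRing R] {p : ℕ} (hp : 0 < p) (j : ℕ) (f : R[X]) (n : ℕ) :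
    (sect p j f).coeff n = f.coeff (n * p + j) := by
  simp only [sect, finsetSum_coeff, coeff_monomial, Finset.sum_ite_eq', Finset.mem_range]
  split_ifs with h
  · rfl
  · rw [coeff_eq_zero_of_natDegree_lt]
    nlinarith

theorem coeff_sum_X_pow_mul_expand {R : Type*} [CommRing R] {p : ℕ} (d : ℕ → R[X]) {j : ℕ}
    (hj : j < p) (n : ℕ) :
    (∑ i ∈ Finset.range p, X ^ i * expand R p (d i)).coeff (n * p + j) = (d j).coeff n := by
  have hp : 0 < p := by omega
  rw [finsetSum_coeff, Finset.sum_eq_single j]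
  · rw [add_comm, add_comm j, coeff_X_pow_mul, coeff_expand_mul hp]
  · intro i hi hij
    rw [Finset.mem_range] at hi
    rw [coeff_X_pow_mul', coeff_expand hp]
    split_ifs with h1 h2
    · exfalso
      obtain ⟨c, hc⟩ := h2
      have h3 : (p * c + i) % p = (n * p + j) % p := by congr 1; omega
      rw [Nat.mul_add_mod, Nat.mod_eq_of_lt hi, Nat.mul_add_mod_self_right,
        Nat.mod_eq_of_lt hj] at h3
      exact hij h3
    · rfl
    · rfl
  · simp [hj]

theorem sum_X_pow_mul_expand_sect {R : Type*} [CommRing R] {p : ℕ} (hp : 0 < p) (f : R[X]) :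
    ∑ i ∈ Finset.range p, X ^ i * expand R p (sect p i f) = f := by
  ext k
  rw [← Nat.div_add_mod' k p, coeff_sum_X_pow_mul_expand _ (Nat.mod_lt _ hp), coeff_sect hp]

theorem sect_expand_mul {R : Type*} [CommRing R] {p j : ℕ} (hj : j < p) (a f : R[X]) :
    sect p j (expand R p a * f) = a * sect p j f := by
  have hp : 0 < p := by omega
  ext n
  rw [coeff_sect hp, ← coeff_sum_X_pow_mul_expand (fun i => a * sect p i f) hj]
  congr 1
  conv_lhs => rw [← sum_X_pow_mul_expand_sect hp f]
  rw [Finset.mul_sum]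
  refine Finset.sum_congr rfl fun i _ => ?_
  rw [map_mul]
  ring

theorem card_support_sect {R : Type*} [CommRing R] {p j : ℕ} (hj : j < p) (f : R[X]) :
    (sect p j f).support.card = (f.support.filter (fun k => k % p = j)).card := by
  have hp : 0 < p := by omega
  refine Finset.card_bij (fun n _ => n * p + j) ?_ ?_ ?_
  · intro n hn
    rw [mem_support_iff, coeff_sect hp] at hn
    simp [hn, Nat.mod_eq_of_lt hj]
  · intro a _ b _ h
    exact Nat.eq_of_mul_eq_mul_right hp (Nat.add_right_cancel h)
  · intro k hk
    rw [Finset.mem_filter, mem_support_iff] at hk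
    have hk' : k / p * p + j = k := by rw [← hk.2, Nat.div_add_mod']
    refine ⟨k / p, ?_, hk'⟩
    rw [mem_support_iff, coeff_sect hp, hk']
    exact hk.1

theorem card_support_eq_sum_sect {R : Type*} [CommRing R] {p : ℕ} (hp : 0 < p) (f : R[X]) :
    f.support.card = ∑ j ∈ Finset.range p, (sect p j f).support.card := by
  rw [Finset.card_eq_sum_card_fiberwise (f := fun k => k % p) (t := Finset.range p)]
  · exact Finset.sum_congr rfl fun j hj => (card_support_sect (Finset.mem_range.1 hj) f).symm
  · intro k _
    simpa using Nat.mod_lt k hp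

theorem card_support_X_pow_mul {R : Type*} [CommRing R] (n : ℕ) (f : R[X]) :
    (X ^ n * f).support.card = f.support.card := by
  refine (Finset.card_bij (fun k _ => k + n) ?_ ?_ ?_).symm
  · intro k hk
    simpa [coeff_X_pow_mul] using hk
  · intro a _ b _ h
    exact Nat.add_right_cancel h
  · intro k hk
    rw [mem_support_iff, coeff_X_pow_mul'] at hk
    split_ifs at hk with h
    · exact ⟨k - n, by simpa using hk, by omega⟩
    · exact absurd rfl hk

/-- Differentiation kills the constant term and can only shift or kill each other term. -/
theorem card_support_derivative_lt {R : Type*} [CommRing R] {f : R[X]} (hf : f.coeff 0 ≠ 0) :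
    (derivative f).support.card < f.support.card := by
  have h0 : 0 ∈ f.support := mem_support_iff.2 hf
  rw [← Finset.card_erase_add_one h0, Nat.lt_succ_iff]
  refine Finset.card_le_card_of_injOn (fun k => k + 1) ?_ ?_
  · intro k hk
    rw [Finset.mem_coe, mem_support_iff, coeff_derivative] at hk
    simp only [Finset.coe_erase, Set.mem_sdiff, Finset.mem_coe, mem_support_iff]
    exact ⟨left_ne_zero_of_mul hk, by simp⟩
  · intro a _ b _ h
    exact Nat.add_right_cancel h

/-! ### Root multiplicity and number of terms below degree p -/

variable {F : Type*} [Field F]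

theorem derivative_ne_zero_of_natDegree_lt {p : ℕ} [CharP F p] {f : F[X]}
    (h0 : 0 < f.natDegree) (hp : f.natDegree < p) : derivative f ≠ 0 := by
  intro h
  have h1 : (derivative f).coeff (f.natDegree - 1) = 0 := by rw [h, coeff_zero]
  rw [coeff_derivative, Nat.sub_add_cancel h0, coeff_natDegree] at h1
  have h2 : ((f.natDegree : ℕ) : F) = 0 := by
    rcases mul_eq_zero.1 h1 with h1 | h1
    · rw [leadingCoeff_eq_zero.1 h1] at h0
      simp at h0
    · rw [← h1, ← Nat.cast_add_one, Nat.sub_add_cancel h0]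
  rw [CharP.cast_eq_zero_iff F p] at h2
  exact absurd (Nat.le_of_dvd h0 h2) (by omega)

/-- A nonzero polynomial of degree less than the characteristic with a nonzero root of
multiplicity `t` has more than `t` terms. -/
theorem lt_card_support_of_natDegree_lt {p : ℕ} [CharP F p] {a : F} (ha : a ≠ 0) (t : ℕ) :
    ∀ f : F[X], f ≠ 0 → f.natDegree < p → (X - C a) ^ t ∣ f → t < f.support.card := by
  induction t with
  | zero =>
    intro f hf _ _
    exact Finset.card_pos.2 (nonempty_support_iff.2 hf)
  | succ t ih =>
    intro f hf hdeg hdvd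
    -- Strip the power of X, which is coprime to X - a: the number of terms is unchanged, and the
    -- constant term becomes nonzero, so differentiating loses a term and only one order of the
    -- root.
    obtain ⟨g, hg, hXg⟩ := exists_eq_pow_rootMultiplicity_mul_and_not_dvd f hf 0
    rw [C_0, sub_zero] at hg hXg
    set k := rootMultiplicity 0 f
    have hg0 : g ≠ 0 := by
      rintro rfl
      exact hXg (dvd_zero _)
    have hcop : IsCoprime ((X - C a) ^ (t + 1)) (X ^ k) := by
      refine IsCoprime.pow ?_
      have := isCoprime_X_sub_C_of_isUnit_sub (R := F) (a := a) (b := 0) (by simpa using ha)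
      simpa using this
    have hdg : (X - C a) ^ (t + 1) ∣ g := by
      rw [hg] at hdvd
      exact hcop.dvd_of_dvd_mul_left hdvd
    have hgf : g.natDegree ≤ f.natDegree := by
      rw [hg, natDegree_mul (pow_ne_zero _ X_ne_zero) hg0]
      omega
    have hgt : t + 1 ≤ g.natDegree := by
      have := natDegree_le_of_dvd hdg hg0
      simpa using this
    have hder : derivative g ≠ 0 :=
      derivative_ne_zero_of_natDegree_lt (p := p) (by omega) (by omega)
    have hdd : (X - C a) ^ t ∣ derivative g := by
      have := pow_sub_one_dvd_derivative_of_pow_dvd hdg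
      simpa using this
    have h1 := ih _ hder (lt_of_le_of_lt (natDegree_derivative_le g) (by omega)) hdd
    have h2 : (derivative g).support.card < g.support.card := by
      apply card_support_derivative_lt
      rwa [Ne, ← X_dvd_iff]
    rw [hg, card_support_X_pow_mul]
    omega

/-! ### Products of incremented base-p digits -/

/-- The product of `d + 1` over the base-`p` digits `d` of `t`. -/
def digitWeight (p t : ℕ) : ℕ := ((Nat.digits p t).map (· + 1)).prod

theorem digitWeight_mul_add {p d : ℕ} (hp : 1 < p) (t : ℕ) (hd : d < p) :
    digitWeight p (p * t + d) = (d + 1) * digitWeight p t := by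
  by_cases h : d ≠ 0 ∨ t ≠ 0
  · rw [digitWeight, add_comm, Nat.digits_add p hp d t hd h]
    simp [digitWeight]
  · push Not at h
    simp [h.1, h.2, digitWeight]

theorem digitWeight_pow_sub_one {p : ℕ} (hp : 1 < p) (r : ℕ) :
    digitWeight p (p ^ r - 1) = p ^ r := by
  induction r with
  | zero => simp [digitWeight]
  | succ r ih =>
    have h : p ^ (r + 1) - 1 = p * (p ^ r - 1) + (p - 1) := by
      have : 0 < p ^ r := by positivity
      obtain ⟨x, hx⟩ := Nat.exists_eq_add_of_lt this
      obtain ⟨y, hy⟩ := Nat.exists_eq_add_of_lt hp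
      rw [pow_succ, hx, hy]
      simp only [zero_add, Nat.add_sub_cancel]
      rw [Nat.sub_eq_iff_eq_add (by nlinarith)]
      ring
    rw [h, digitWeight_mul_add hp _ (by omega), ih, pow_succ, mul_comm, Nat.sub_add_cancel hp.le]

theorem digitWeight_mul_pow {p : ℕ} (hp : 1 < p) (t k : ℕ) :
    digitWeight p (t * p ^ k) = digitWeight p t := by
  induction k with
  | zero => simp
  | succ k ih =>
    have := digitWeight_mul_add hp (t * p ^ k) (d := 0) (by omega)
    rw [zero_add, one_mul, ih] at this
    rw [← this]
    congr 1
    ring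

/-- The lower bound on t has base-p digits p - 1 (r times), then Γ - 1, then k zeros. A larger t
with at most r + 1 + k digits either has its first r digits equal to p - 1 and the next at least Γ,
or shares these r + 1 digits and has a nonzero digit further down. The product is then at least (Γ +
1)p^r or 2Γp^r. The induction peels off the last digit. -/
theorem le_digitWeight {p Γ r : ℕ} (hp : 1 < p) (hΓ : 1 ≤ Γ) (hΓp : Γ < p) (k : ℕ) :
    ∀ t, t < p ^ (r + 1 + k) → (p * (p ^ r - 1) + (Γ - 1)) * p ^ k < t →
      (Γ + 1) * p ^ r ≤ digitWeight p t := by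
  have hr : 0 < p ^ r := by positivity
  induction k with
  | zero =>
    intro t ht hlt
    rw [pow_zero, mul_one] at hlt
    have hq : t / p = p ^ r - 1 := by
      have h1 : p ^ r - 1 ≤ t / p := by
        rw [Nat.le_div_iff_mul_le (by omega), mul_comm]
        omega
      have h2 : t / p < p ^ r := by
        rw [Nat.div_lt_iff_lt_mul (by omega), ← pow_succ]
        exact ht
      omega
    have hdm := Nat.div_add_mod t p
    have hm := Nat.mod_lt t (show p > 0 by omega)
    rw [hq] at hdm
    rw [← hdm, digitWeight_mul_add hp _ hm, digitWeight_pow_sub_one hp]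
    exact Nat.mul_le_mul_right _ (by omega)
  | succ k ih =>
    intro t ht hlt
    have hdm := Nat.div_add_mod t p
    have hm := Nat.mod_lt t (show p > 0 by omega)
    have h2 : t / p < p ^ (r + 1 + k) := by
      rw [Nat.div_lt_iff_lt_mul (by omega), ← pow_succ]
      exact ht
    have h1 : (p * (p ^ r - 1) + (Γ - 1)) * p ^ k ≤ t / p := by
      rw [Nat.le_div_iff_mul_le (by omega), mul_assoc, ← pow_succ]
      exact hlt.le
    rw [← hdm, digitWeight_mul_add hp _ hm]
    rcases h1.lt_or_eq with h1 | h1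
    -- Here the leading digits already suffice, and the last digit contributes a factor at least 1.
    · exact (ih _ h2 h1).trans (Nat.le_mul_of_pos_left _ (by omega))
    · have h3 : 0 < t % p := by
        rw [← hdm, ← h1, pow_succ] at hlt
        by_contra h
        have h0 : t % p = 0 := by omega
        rw [h0] at hlt
        apply lt_irrefl _ (lt_of_lt_of_eq hlt _)
        ring
      rw [← h1, digitWeight_mul_pow hp, digitWeight_mul_add hp _ (by omega),
        digitWeight_pow_sub_one hp, ← mul_assoc]
      refine Nat.mul_le_mul_right _ ?_
      rw [Nat.sub_add_cancel hΓ]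
      nlinarith

/-! ### The digit bound on the number of terms, and its sharpness -/

theorem expand_X_sub_C_pow {p : ℕ} [Fact p.Prime] [CharP F p] (a : F) (k n : ℕ) :
    expand F (p ^ k) ((X - C (a ^ p ^ k)) ^ n) = (X - C a) ^ (p ^ k * n) := by
  rw [pow_mul, sub_pow_char_pow]
  simp

/-- A polynomial with a nonzero root of multiplicity exactly `t` in characteristic `p` has at
least `∏ (tᵢ + 1)` terms, where the `tᵢ` are the base-`p` digits of `t`. -/
theorem digitWeight_le_card_support {p : ℕ} [Fact p.Prime] [CharP F p] (t : ℕ) :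
    ∀ (a : F) (g : F[X]), a ≠ 0 → g.eval a ≠ 0 →
      digitWeight p t ≤ ((X - C a) ^ t * g).support.card := by
  have hp : 1 < p := (Fact.out : p.Prime).one_lt
  have hp0 : 0 < p := by omega
  induction t using Nat.strong_induction_on with
  | _ t ih =>
  intro a g ha hg
  rcases Nat.eq_zero_or_pos t with rfl | ht
  · rw [pow_zero, one_mul]
    simp only [digitWeight, Nat.digits_zero, List.map_nil, List.prod_nil]
    refine Finset.card_pos.2 (nonempty_support_iff.2 ?_)
    rintro rfl
    simp at hg
  have hdm := Nat.div_add_mod t p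
  have hm := Nat.mod_lt t hp0
  set e := t / p with he
  set d := t % p
  set h := (X - C a) ^ d * g with hh
  set b := a ^ p with hb
  have hexp : ∀ n, expand F p ((X - C b) ^ n) = (X - C a) ^ (p * n) := by
    intro n
    have := expand_X_sub_C_pow (p := p) a 1 n
    rwa [pow_one] at this
  have hf : (X - C a) ^ t * g = expand F p ((X - C b) ^ e) * h := by
    rw [hexp, ← hdm, pow_add, hh, mul_assoc]
  -- This is the remainder of h modulo X^p - b = (X - a)^p: each section of h is replaced by its
  -- value at b.
  set r : F[X] := ∑ i ∈ Finset.range p, X ^ i * expand F p (C ((sect p i h).eval b)) with hr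
  have hrcoeff : ∀ j < p, r.coeff j = (sect p j h).eval b := by
    intro j hj
    have := coeff_sum_X_pow_mul_expand (fun i => C ((sect p i h).eval b)) hj 0
    rwa [zero_mul, zero_add, coeff_C_zero] at this
  have hdiv : (X - C a) ^ p ∣ h - r := by
    have h1 : h - r = ∑ i ∈ Finset.range p,
        X ^ i * expand F p (sect p i h - C ((sect p i h).eval b)) := by
      conv_lhs => rw [← sum_X_pow_mul_expand_sect hp0 h, hr, ← Finset.sum_sub_distrib]
      refine Finset.sum_congr rfl fun i _ => ?_
      rw [map_sub, mul_sub]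
    rw [h1]
    refine Finset.dvd_sum fun i _ => Dvd.dvd.mul_left ?_ _
    have h2 := hexp 1
    rw [mul_one, pow_one] at h2
    obtain ⟨q, hq⟩ := X_sub_C_dvd_sub_C_eval (a := b) (p := sect p i h)
    rw [← h2, hq, map_mul]
    exact dvd_mul_right _ _
  have hr0 : r ≠ 0 := by
    intro h0
    rw [h0, sub_zero, hh] at hdiv
    have h1 : (X - C a) ^ (d + 1) ∣ (X - C a) ^ d * g := (pow_dvd_pow _ (by omega)).trans hdiv
    rw [pow_succ, mul_dvd_mul_iff_left (pow_ne_zero _ (X_sub_C_ne_zero a)), dvd_iff_isRoot] at h1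
    exact hg h1
  have hrdeg : r.natDegree < p := by
    refine lt_of_le_of_lt (natDegree_sum_le_of_forall_le _ _ (n := p - 1) fun i hi => ?_)
      (by omega)
    rw [expand_C, mul_comm]
    have := Finset.mem_range.1 hi
    exact (natDegree_C_mul_X_pow_le _ _).trans (by omega)
  have hrdvd : (X - C a) ^ d ∣ r := by
    have h1 : (X - C a) ^ d ∣ h - r := (pow_dvd_pow _ hm.le).trans hdiv
    have h2 : (X - C a) ^ d ∣ h := dvd_mul_right _ _
    exact (dvd_sub_right h2).1 h1
  have hcard := lt_card_support_of_natDegree_lt (p := p) ha d r hr0 hrdeg hrdvd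
  have hsub : r.support ⊆ Finset.range p := fun j hj =>
    Finset.mem_range.2 (lt_of_le_of_lt (le_natDegree_of_mem_supp j hj) hrdeg)
  -- Each j in the support of r indexes a section (X - b)^e · (section of h) whose cofactor does not
  -- vanish at b. Induction gives it the weight of e, and r has more than d terms.
  have hpart : ∀ j ∈ r.support,
      digitWeight p e ≤ (sect p j ((X - C a) ^ t * g)).support.card := by
    intro j hj
    have hjp := Finset.mem_range.1 (hsub hj)
    rw [hf, sect_expand_mul hjp]
    refine ih e (Nat.div_lt_self ht hp) b _ (pow_ne_zero _ ha) ?_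
    rw [← hrcoeff j hjp]
    exact mem_support_iff.1 hj
  calc digitWeight p t = (d + 1) * digitWeight p e := by
        rw [← hdm, digitWeight_mul_add hp _ hm]
    _ ≤ r.support.card * digitWeight p e := Nat.mul_le_mul_right _ hcard
    _ = ∑ _j ∈ r.support, digitWeight p e := by simp
    _ ≤ ∑ j ∈ r.support, (sect p j ((X - C a) ^ t * g)).support.card := Finset.sum_le_sum hpart
    _ ≤ ∑ j ∈ Finset.range p, (sect p j ((X - C a) ^ t * g)).support.card :=
        Finset.sum_le_sum_of_subset hsub
    _ = _ := (card_support_eq_sum_sect hp0 _).symm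

theorem le_card_support_of_dvd {p : ℕ} [Fact p.Prime] [CharP F p] {a : F} (ha : a ≠ 0)
    {Γ r k i : ℕ} (hΓ : 1 ≤ Γ) (hΓp : Γ < p)
    (hi : (p * (p ^ r - 1) + (Γ - 1)) * p ^ k < i) {f : F[X]} (hf : f ≠ 0)
    (hdeg : f.natDegree < p ^ (r + 1 + k)) (hdvd : (X - C a) ^ i ∣ f) :
    (Γ + 1) * p ^ r ≤ f.support.card := by
  obtain ⟨g, hg, hng⟩ := exists_eq_pow_rootMultiplicity_mul_and_not_dvd f hf a
  have hi' : i ≤ rootMultiplicity a f := (le_rootMultiplicity_iff hf).2 hdvd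
  have ht : rootMultiplicity a f ≤ f.natDegree := by
    have := natDegree_le_of_dvd (pow_rootMultiplicity_dvd f a) hf
    simpa using this
  rw [dvd_iff_isRoot] at hng
  calc (Γ + 1) * p ^ r ≤ digitWeight p (rootMultiplicity a f) :=
        le_digitWeight (Fact.out : p.Prime).one_lt hΓ hΓp k _ (by omega) (by omega)
    _ ≤ _ := by
        conv_rhs => rw [hg]
        exact digitWeight_le_card_support _ a g ha hng

theorem card_support_expand_le {R : Type*} [CommRing R] {p : ℕ} (hp : 0 < p) (f : R[X]) :
    (expand R p f).support.card ≤ f.support.card := by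
  refine (Finset.card_le_card (t := f.support.image (· * p)) ?_).trans Finset.card_image_le
  intro k hk
  rw [mem_support_iff, coeff_expand hp] at hk
  split_ifs at hk with h
  · exact Finset.mem_image.2 ⟨k / p, mem_support_iff.2 hk, Nat.div_mul_cancel h⟩
  · exact absurd rfl hk

/-- Put q = p^k. By Frobenius the power equals (X^q - a^q)^Γ times (X^(pq) - a^(pq))^(p^r - 1), with
at most Γ + 1 and p^r terms in the two factors. -/
theorem card_support_X_sub_C_pow_le {p : ℕ} [Fact p.Prime] [CharP F p] (a : F) (Γ r k : ℕ) :
    ((X - C a) ^ ((p * (p ^ r - 1) + Γ) * p ^ k)).support.card ≤ (Γ + 1) * p ^ r := by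
  have hp : 0 < p := (Fact.out : p.Prime).pos
  have hr : 0 < p ^ r := by positivity
  have hlin : ∀ (b : F) (n : ℕ), ((X - C b) ^ n).support.card ≤ n + 1 := fun b n => by
    have := card_supp_le_succ_natDegree ((X - C b) ^ n)
    rwa [natDegree_pow, natDegree_X_sub_C, mul_one] at this
  rw [mul_comm, ← expand_X_sub_C_pow]
  refine (card_support_expand_le (by positivity) _).trans ?_
  have h1 := expand_X_sub_C_pow (p := p) (a ^ p ^ k) 1 (p ^ r - 1)
  rw [pow_one] at h1
  rw [add_comm, pow_add, ← h1]
  refine card_support_mul_le.trans (Nat.mul_le_mul (hlin _ _) ?_)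
  refine ((card_support_expand_le hp _).trans (hlin _ _)).trans ?_
  omega

/-! ### Words as polynomials of degree below n -/

theorem coeff_wordPoly {R : Type*} [CommRing R] {n : ℕ} (c : Fin n → R) (j : Fin n) :
    (wordPoly c).coeff j = c j := by
  rw [wordPoly, finsetSum_coeff, Finset.sum_eq_single j]
  · simp
  · intro i _ hij
    rw [coeff_C_mul_X_pow, if_neg fun h => hij (Fin.ext h.symm)]
  · simp

theorem degree_wordPoly_lt {R : Type*} [CommRing R] {n : ℕ} (c : Fin n → R) :
    (wordPoly c).degree < n := by
  rw [← mem_degreeLT]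
  refine Submodule.sum_mem _ fun i _ => mem_degreeLT.2 ?_
  refine lt_of_le_of_lt (degree_C_mul_X_pow_le _ _) ?_
  exact_mod_cast i.2

theorem wordPoly_coeff {R : Type*} [CommRing R] {n : ℕ} {f : R[X]} (hf : f.degree < n) :
    wordPoly (fun j : Fin n => f.coeff j) = f := by
  ext k
  by_cases hk : k < n
  · exact coeff_wordPoly _ ⟨k, hk⟩
  · have hk' : (n : WithBot ℕ) ≤ k := by exact_mod_cast not_lt.1 hk
    rw [coeff_eq_zero_of_degree_lt ((degree_wordPoly_lt _).trans_le hk'),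
      coeff_eq_zero_of_degree_lt (hf.trans_le hk')]

theorem wordPoly_injective {R : Type*} [CommRing R] {n : ℕ} :
    Function.Injective (wordPoly : (Fin n → R) → R[X]) := fun c d h => by
  ext j
  rw [← coeff_wordPoly c, h, coeff_wordPoly]

theorem wordPoly_sub {R : Type*} [CommRing R] {n : ℕ} (c d : Fin n → R) :
    wordPoly (c - d) = wordPoly c - wordPoly d := by
  simp [wordPoly, sub_mul]

theorem wordPoly_zero {R : Type*} [CommRing R] {n : ℕ} : wordPoly (0 : Fin n → R) = 0 := by
  simp [wordPoly]

theorem wordPoly_mul_map {F R : Type*} [CommRing F] [CommRing R] (φ : F →+* R) (a : R) {n : ℕ}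
    (g : Fin n → F) :
    wordPoly (fun j => a * φ (g j)) = C a * (wordPoly g).map φ := by
  simp [wordPoly, Polynomial.map_sum, Finset.mul_sum, mul_assoc]

/-! ### Symbol-pair distance -/

theorem val_finRotate_mod_two {n : ℕ} (hn : Even n) (i : Fin n) :
    (finRotate n i : ℕ) % 2 ≠ (i : ℕ) % 2 := by
  obtain _ | n := n
  · exact i.elim0
  rw [finRotate_apply, Fin.val_add_one]
  rw [Nat.even_iff] at hn
  split_ifs with h
  · rw [h, Fin.val_last]
    omega
  · omega

/-- A differing position i spoils only the pairs starting at i and at i - 1. -/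
theorem pairDist_le_two_mul {A : Type*} {n : ℕ} (x y : Fin n → A) (S : Finset (Fin n))
    (hS : ∀ i, x i ≠ y i → i ∈ S) : pairDist x y ≤ 2 * S.card := by
  classical
  have hsub : {i : Fin n | (x i, x (finRotate n i)) ≠ (y i, y (finRotate n i))} ⊆
      ((S ∪ S.image (finRotate n).symm : Finset (Fin n)) : Set (Fin n)) := by
    intro i hi
    rw [Set.mem_ofPred_eq, Ne, Prod.mk.injEq, not_and_or] at hi
    rw [Finset.mem_coe, Finset.mem_union]
    rcases hi with hi | hi
    · exact Or.inl (hS i hi)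
    · exact Or.inr (Finset.mem_image.2 ⟨_, hS _ hi, Equiv.symm_apply_apply _ _⟩)
  have h1 := Set.ncard_le_ncard hsub (Finset.finite_toSet _)
  rw [Set.ncard_coe_finset] at h1
  have h2 := Finset.card_union_le S (S.image (finRotate n).symm)
  have h3 : (S.image (finRotate n).symm).card ≤ S.card := Finset.card_image_le
  unfold pairDist
  omega

theorem two_mul_le_pairDist {A : Type*} {n : ℕ} (x y : Fin n → A) (S : Finset (Fin n))
    (hS : ∀ i ∈ S, x i ≠ y i) (hrot : ∀ i ∈ S, finRotate n i ∉ S) :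
    2 * S.card ≤ pairDist x y := by
  classical
  have hsub : ((S ∪ S.image (finRotate n).symm : Finset (Fin n)) : Set (Fin n)) ⊆
      {i : Fin n | (x i, x (finRotate n i)) ≠ (y i, y (finRotate n i))} := by
    intro i hi
    rw [Finset.mem_coe, Finset.mem_union] at hi
    rw [Set.mem_ofPred_eq, Ne, Prod.mk.injEq, not_and_or]
    rcases hi with hi | hi
    · exact Or.inl (hS i hi)
    · obtain ⟨j, hj, rfl⟩ := Finset.mem_image.1 hi
      right
      rw [Equiv.apply_symm_apply]
      exact hS j hj
  have hdisj : Disjoint S (S.image (finRotate n).symm) := by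
    rw [Finset.disjoint_left]
    intro i hi hi'
    obtain ⟨j, hj, rfl⟩ := Finset.mem_image.1 hi'
    apply hrot _ hi
    rwa [Equiv.apply_symm_apply]
  have h1 := Set.ncard_le_ncard hsub (Set.toFinite _)
  rw [Set.ncard_coe_finset, Finset.card_union_of_disjoint hdisj,
    Finset.card_image_of_injective _ (Equiv.injective _)] at h1
  unfold pairDist
  omega

theorem codePairDist_eq {A : Type*} {n d : ℕ} {𝒞 : Set (Fin n → A)}
    (hex : ∃ x ∈ 𝒞, ∃ y ∈ 𝒞, x ≠ y ∧ pairDist x y ≤ d)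
    (hle : ∀ x ∈ 𝒞, ∀ y ∈ 𝒞, x ≠ y → d ≤ pairDist x y) : codePairDist 𝒞 = d := by
  obtain ⟨x, hx, y, hy, hxy, hd⟩ := hex
  have hmem : pairDist x y ∈ {d : ℕ | ∃ x ∈ 𝒞, ∃ y ∈ 𝒞, x ≠ y ∧ pairDist x y = d} :=
    ⟨x, hx, y, hy, hxy, rfl⟩
  -- Nonemptiness is needed for the lower bound, since the infimum of the empty set is 0.
  refine le_antisymm ((Nat.sInf_le hmem).trans hd) (le_csInf ⟨_, hmem⟩ ?_)
  rintro _ ⟨x, hx, y, hy, hxy, rfl⟩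
  exact hle x hx y hy hxy

theorem two_le_pairDist {A : Type*} {n : ℕ} (hn : Even n) {x y : Fin n → A} (hxy : x ≠ y) :
    2 ≤ pairDist x y := by
  obtain ⟨i, hi⟩ := Function.ne_iff.1 hxy
  refine two_mul_le_pairDist x y {i} (by simpa using hi) fun j hj h => ?_
  rw [Finset.mem_singleton] at hj h
  subst hj
  apply val_finRotate_mod_two hn j
  rw [h]

/-! ### Arithmetic in 𝓡 -/

theorem u_mul_u : u F * u F = 0 := by
  rw [u, ← map_mul, ← sq]
  exact Ideal.Quotient.eq_zero_iff_mem.2 (Ideal.subset_span (by simp))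

theorem v_mul_v : v F * v F = 0 := by
  rw [v, ← map_mul, ← sq]
  exact Ideal.Quotient.eq_zero_iff_mem.2 (Ideal.subset_span (by simp))

/-- The realization of `𝓡` in the iterated dual numbers `F[ε][ε']`. -/
def toDual (F : Type*) [Field F] : RingR F →ₐ[F] DualNumber (DualNumber F) :=
  Ideal.Quotient.liftₐ (relIdeal F)
    (MvPolynomial.aeval ![TrivSqZeroExt.inl (DualNumber.eps : DualNumber F), DualNumber.eps]) <| by
  intro a ha
  rw [← RingHom.mem_ker]
  revert a
  change relIdeal F ≤ _
  rw [relIdeal, Ideal.span_le]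
  rintro _ (rfl | rfl | rfl)
  · simp [RingHom.mem_ker, sq, ← TrivSqZeroExt.inl_mul]
  · simp [RingHom.mem_ker, sq]
  · simp [mul_comm]

/-- In the iterated dual numbers uv becomes εε', so the εε'-coordinate recovers a. -/
theorem uv_mul_const_eq_zero {a : F} (h : u F * v F * const a = 0) : a = 0 := by
  have h1 := congrArg (toDual F) h
  have hu : toDual F (u F) = TrivSqZeroExt.inl (DualNumber.eps : DualNumber F) := by
    exact (MvPolynomial.aeval_X _ _)
  have hv : toDual F (v F) = DualNumber.eps := by
    exact (MvPolynomial.aeval_X _ _)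
  rw [map_mul, map_mul, hu, hv, const, AlgHom.commutes, map_zero, ← Algebra.commutes,
    ← Algebra.smul_def] at h1
  have h2 := congrArg (fun z => TrivSqZeroExt.snd (TrivSqZeroExt.snd z)) h1
  simpa using h2

instance : Nontrivial (RingR F) :=
  ⟨u F * v F, 0, fun h => one_ne_zero (uv_mul_const_eq_zero (F := F) (a := 1) (by rw [h, zero_mul]))⟩

theorem exists_uv_mul_eq (r : RingR F) : ∃ a : F, u F * v F * r = u F * v F * const a := by
  obtain ⟨q, rfl⟩ := Ideal.Quotient.mk_surjective r
  induction q using MvPolynomial.induction_on with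
  | C a => exact ⟨a, rfl⟩
  | add q₁ q₂ h₁ h₂ =>
    obtain ⟨a, ha⟩ := h₁
    obtain ⟨b, hb⟩ := h₂
    refine ⟨a + b, ?_⟩
    rw [map_add, mul_add, ha, hb, const, const, const, map_add, mul_add]
  | mul_X q i _ =>
    refine ⟨0, ?_⟩
    rw [const, map_zero, mul_zero, map_mul]
    fin_cases i
    · change u F * v F * (_ * u F) = 0
      linear_combination (v F * Ideal.Quotient.mk (relIdeal F) q) * u_mul_u (F := F)
    · change u F * v F * (_ * v F) = 0
      linear_combination (u F * Ideal.Quotient.mk (relIdeal F) q) * v_mul_v (F := F)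

theorem exists_C_uv_mul_eq (f : (RingR F)[X]) :
    ∃ g : F[X], C (u F * v F) * f = C (u F * v F) * g.map (algebraMap F (RingR F)) := by
  induction f using Polynomial.induction_on' with
  | add f₁ f₂ h₁ h₂ =>
    obtain ⟨a, ha⟩ := h₁
    obtain ⟨b, hb⟩ := h₂
    exact ⟨a + b, by rw [mul_add, ha, hb, Polynomial.map_add, mul_add]⟩
  | monomial n r =>
    obtain ⟨a, ha⟩ := exists_uv_mul_eq r
    refine ⟨monomial n a, ?_⟩
    rw [map_monomial, C_mul_monomial, C_mul_monomial, ha, const]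

/-! ### Reduction of the code to a code over F -/

theorem u_mul_elemR (a₁ a₂ a₃ a₄ : F) :
    u F * elemR a₁ a₂ a₃ a₄ = u F * const a₁ + u F * v F * const a₃ := by
  rw [elemR]
  linear_combination (const a₂ + const a₄ * v F) * u_mul_u (F := F)

theorem uv_mul_elemR (a₁ a₂ a₃ a₄ : F) :
    u F * v F * elemR a₁ a₂ a₃ a₄ = u F * v F * const a₁ := by
  rw [elemR]
  linear_combination (const a₂ * v F + const a₄ * v F * v F) * u_mul_u (F := F) +
    const a₃ * u F * v_mul_v (F := F)

/-- Modulo `xⁿ - α`, the element `u (x² - α₀) ^ N`, where `(x² - α₀) ^ N = xⁿ - α₁`, is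
`α₃ u v`. -/
theorem C_u_mul_pow_eq {n N : ℕ} {a₀ a₁ : F} (a₂ a₃ a₄ : F)
    (hN : (X ^ 2 - C a₀ : F[X]) ^ N = X ^ n - C a₁) :
    (C (u F) * (X ^ 2 - C (const a₀)) ^ N : (RingR F)[X]) =
      C (u F) * (X ^ n - C (elemR a₁ a₂ a₃ a₄)) + C (const a₃) * C (u F * v F) := by
  have h := congrArg (Polynomial.map (algebraMap F (RingR F))) hN
  simp only [Polynomial.map_pow, Polynomial.map_sub, Polynomial.map_X, Polynomial.map_C] at h
  change (X ^ 2 - C (const a₀) : (RingR F)[X]) ^ N = X ^ n - C (const a₁) at h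
  have h1 := congrArg (C : RingR F → (RingR F)[X]) (u_mul_elemR a₁ a₂ a₃ a₄)
  simp only [C_add, C_mul] at h1 ⊢
  rw [h]
  linear_combination h1

theorem mk_C_u_mul_pow {n N : ℕ} {a₀ a₁ : F} (a₂ a₃ a₄ : F)
    (hN : (X ^ 2 - C a₀ : F[X]) ^ N = X ^ n - C a₁) (i : ℕ) :
    AdjoinRoot.mk (X ^ n - C (elemR a₁ a₂ a₃ a₄))
        (C (u F) * (X ^ 2 - C (const a₀)) ^ (N + i) : (RingR F)[X]) =
      AdjoinRoot.mk _ (C (const a₃) * (C (u F * v F) * (X ^ 2 - C (const a₀)) ^ i)) := by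
  rw [AdjoinRoot.mk_eq_mk]
  refine ⟨C (u F) * (X ^ 2 - C (const a₀)) ^ i, ?_⟩
  rw [pow_add]
  linear_combination (X ^ 2 - C (const a₀) : (RingR F)[X]) ^ i * C_u_mul_pow_eq a₂ a₃ a₄ hN

theorem const_mul_const_inv {a : F} (ha : a ≠ 0) : const a * const a⁻¹ = 1 := by
  rw [const, const, ← map_mul, mul_inv_cancel₀ ha, map_one]

theorem mk_C_uv_mem_typeB {n N : ℕ} {a₀ a₁ a₃ : F} (a₂ a₄ : F) (ha₃ : a₃ ≠ 0)
    (hN : (X ^ 2 - C a₀ : F[X]) ^ N = X ^ n - C a₁) (i : ℕ) :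
    AdjoinRoot.mk _ (C (u F * v F) * (X ^ 2 - C (const a₀)) ^ i) ∈
      typeB n (elemR a₁ a₂ a₃ a₄) a₀ (N + i) := by
  rw [typeB, Ideal.mem_span_singleton, mk_C_u_mul_pow a₂ a₃ a₄ hN]
  refine map_dvd _ ⟨C (const a₃⁻¹), ?_⟩
  have h := congrArg (C : RingR F → (RingR F)[X]) (const_mul_const_inv ha₃)
  simp only [C_mul, C_1] at h ⊢
  linear_combination (-C (u F) * C (v F) * (X ^ 2 - C (const a₀)) ^ i) * h

theorem typeB_antitone (n : ℕ) (α : RingR F) (a₀ : F) : Antitone (typeB n α a₀) := by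
  intro k l hkl
  rw [typeB, typeB, Ideal.span_singleton_le_span_singleton]
  exact map_dvd _ (mul_dvd_mul_left _ (pow_dvd_pow _ hkl))

/-- Since uvα = uvα₁, multiples of uv may be reduced modulo xⁿ - α₁ over F. For i ≤ N the polynomial
(x² - α₀)^i divides this modulus, so it still divides the remainder. -/
theorem mem_codewords_typeB_iff {n N i : ℕ} (hn : n ≠ 0) {a₀ a₁ a₃ : F} (a₂ a₄ : F)
    (ha₃ : a₃ ≠ 0) (hN : (X ^ 2 - C a₀ : F[X]) ^ N = X ^ n - C a₁) (hi : i ≤ N)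
    (c : Fin n → RingR F) :
    c ∈ codewords (typeB n (elemR a₁ a₂ a₃ a₄) a₀ (N + i)) ↔
      ∃ g : Fin n → F, (X ^ 2 - C a₀) ^ i ∣ wordPoly g ∧ c = fun j => u F * v F * const (g j) := by
  constructor
  · intro h
    rw [codewords, Set.mem_ofPred_eq, typeB, Ideal.mem_span_singleton,
      mk_C_u_mul_pow a₂ a₃ a₄ hN] at h
    obtain ⟨f, hf⟩ := h
    obtain ⟨f, rfl⟩ := AdjoinRoot.mk_surjective f
    rw [← map_mul, AdjoinRoot.mk_eq_mk] at hf
    obtain ⟨q, hq⟩ := hf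
    obtain ⟨f', hf'⟩ := exists_C_uv_mul_eq (C (const a₃) * f)
    set D : F[X] := X ^ n - C a₁ with hD
    have hDm : D.Monic := monic_X_pow_sub_C _ hn
    set G : F[X] := (X ^ 2 - C a₀) ^ i * f' with hG
    set r : F[X] := G %ₘ D with hr
    have hrdeg : r.degree < n := by
      have := degree_modByMonic_lt G hDm
      rwa [hD, degree_X_pow_sub_C (Nat.pos_of_ne_zero hn)] at this
    have hdiv : G = r + D * (G /ₘ D) := (modByMonic_add_div G D).symm
    have hiD : (X ^ 2 - C a₀) ^ i ∣ D := hN ▸ pow_dvd_pow _ hi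
    have hmapG := congrArg (Polynomial.map (algebraMap F (RingR F))) hdiv
    rw [Polynomial.map_add, Polynomial.map_mul, hG, Polynomial.map_mul] at hmapG
    have hmapP : ((X ^ 2 - C a₀ : F[X]) ^ i).map (algebraMap F (RingR F)) =
        (X ^ 2 - C (const a₀)) ^ i := by
      simp [const]
    have hmapD : D.map (algebraMap F (RingR F)) = X ^ n - C (const a₁) := by
      simp [hD, const]
    rw [hmapP, hmapD] at hmapG
    have hα := congrArg (C : RingR F → (RingR F)[X]) (uv_mul_elemR a₁ a₂ a₃ a₄)
    have hdvd : (X ^ n - C (elemR a₁ a₂ a₃ a₄) : (RingR F)[X]) ∣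
        wordPoly c - C (u F * v F) * r.map (algebraMap F (RingR F)) := by
      refine ⟨q + C (u F * v F) * (G /ₘ D).map (algebraMap F (RingR F)), ?_⟩
      simp only [C_mul] at hα hf' hq ⊢
      linear_combination hq + (X ^ 2 - C (const a₀)) ^ i * hf' + C (u F) * C (v F) * hmapG +
        (G /ₘ D).map (algebraMap F (RingR F)) * hα
    have hword : wordPoly (fun j : Fin n => r.coeff j) = r := wordPoly_coeff hrdeg
    refine ⟨fun j => r.coeff j, ?_, ?_⟩
    · rw [hword, hr, modByMonic_eq_sub_mul_div]
      exact dvd_sub (dvd_mul_right _ _) (hiD.mul_right _)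
    · apply wordPoly_injective
      have h1 := wordPoly_mul_map (algebraMap F (RingR F)) (u F * v F)
        (fun j : Fin n => r.coeff j)
      rw [hword] at h1
      change _ = wordPoly (fun j : Fin n => u F * v F * algebraMap F (RingR F) (r.coeff j))
      rw [h1]
      -- The two words are congruent modulo a monic polynomial of degree n and both have degree
      -- below n.
      by_contra hne
      refine (monic_X_pow_sub_C (elemR a₁ a₂ a₃ a₄) hn).not_dvd_of_degree_lt
        (sub_ne_zero.2 hne) ?_ hdvd
      rw [degree_X_pow_sub_C (Nat.pos_of_ne_zero hn), ← h1, ← wordPoly_sub]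
      exact degree_wordPoly_lt _
  · rintro ⟨g, ⟨f, hf⟩, rfl⟩
    have h1 := wordPoly_mul_map (algebraMap F (RingR F)) (u F * v F) g
    change AdjoinRoot.mk (X ^ n - C (elemR a₁ a₂ a₃ a₄))
      (wordPoly (fun j => u F * v F * algebraMap F (RingR F) (g j))) ∈
        typeB n (elemR a₁ a₂ a₃ a₄) a₀ (N + i)
    have hmapP : ((X ^ 2 - C a₀ : F[X]) ^ i).map (algebraMap F (RingR F)) =
        (X ^ 2 - C (const a₀)) ^ i := by
      simp [const]
    rw [h1, hf, Polynomial.map_mul, hmapP, ← mul_assoc, map_mul]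
    exact Ideal.mul_mem_right _ _ (mk_C_uv_mem_typeB a₂ a₄ ha₃ hN i)

theorem card_filter_wordPoly {R : Type*} [CommRing R] {n : ℕ} (g : Fin n → R) (P : ℕ → Prop)
    [DecidablePred P] [DecidablePred fun i : Fin n => g i ≠ 0 ∧ P i] :
    (Finset.univ.filter fun i : Fin n => g i ≠ 0 ∧ P i).card =
      ((wordPoly g).support.filter P).card := by
  refine Finset.card_bij (fun i _ => (i : ℕ)) ?_ (fun _ _ _ _ h => Fin.ext h) ?_
  · intro i hi
    rw [Finset.mem_filter] at hi ⊢
    rw [mem_support_iff, coeff_wordPoly]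
    exact hi.2
  · intro k hk
    rw [Finset.mem_filter, mem_support_iff] at hk
    have hkn : k < n := by
      have h1 := le_degree_of_ne_zero hk.1
      exact_mod_cast h1.trans_lt (degree_wordPoly_lt g)
    refine ⟨⟨k, hkn⟩, ?_, rfl⟩
    rw [Finset.mem_filter, ← coeff_wordPoly g ⟨k, hkn⟩]
    exact ⟨Finset.mem_univ _, hk⟩

/-! ### The element α₀ and the power of x² - α₀ -/

theorem alphaZero_ne_zero {p m s : ℕ} {a : F} (ha : a ≠ 0) : alphaZero p m s a ≠ 0 :=
  pow_ne_zero _ ha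

theorem alphaZero_pow [Fintype F] {p m s : ℕ} (hm : 0 < m) (hF : Fintype.card F = p ^ m)
    (a : F) : alphaZero p m s a ^ p ^ s = a := by
  have hle : s ≤ (s / m + 1) * m := by
    rw [add_mul, one_mul]
    have := Nat.div_add_mod' s m
    have := Nat.mod_lt s hm
    omega
  -- The exponents add up to a multiple of m, so the total power is an iterate of y ↦ y^|F|, the
  -- identity on F.
  rw [alphaZero, ← pow_mul, ← pow_add, Nat.sub_add_cancel hle, mul_comm, pow_mul, ← hF,
    FiniteField.pow_card_pow]

theorem X_sq_sub_C_pow {p : ℕ} [Fact p.Prime] [CharP F p] {s : ℕ} {a₀ a₁ : F}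
    (h : a₀ ^ p ^ s = a₁) : (X ^ 2 - C a₀ : F[X]) ^ p ^ s = X ^ (2 * p ^ s) - C a₁ := by
  rw [sub_pow_char_pow, ← pow_mul, ← C_pow, h]

theorem X_sq_sub_C_pow_eq_expand (a : F) (i : ℕ) :
    (X ^ 2 - C a : F[X]) ^ i = expand F 2 ((X - C a) ^ i) := by
  simp

/-! ### The distance in the two ranges of ℓ -/

theorem codePairDist_typeB_of_le {n N ℓ : ℕ} (hn : n ≠ 0) (hne : Even n) {a₀ a₁ a₃ : F}
    (a₂ a₄ : F) (ha₃ : a₃ ≠ 0) (hN : (X ^ 2 - C a₀ : F[X]) ^ N = X ^ n - C a₁) (hℓ : ℓ ≤ N) :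
    codePairDist (codewords (typeB n (elemR a₁ a₂ a₃ a₄) a₀ ℓ)) = 2 := by
  have hn' : 0 < n := Nat.pos_of_ne_zero hn
  refine codePairDist_eq ⟨fun j => if j = ⟨0, hn'⟩ then u F * v F else 0, ?_, 0, ?_, ?_, ?_⟩
    fun x _ y _ hxy => two_le_pairDist hne hxy
  · refine typeB_antitone n _ a₀ hℓ ?_
    have h1 := mk_C_uv_mem_typeB a₂ a₄ ha₃ hN 0
    rw [pow_zero, mul_one, add_zero] at h1
    convert h1 using 2
    rw [wordPoly, Finset.sum_eq_single ⟨0, hn'⟩]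
    · simp
    · intro j _ hj
      simp [hj]
    · simp
  · rw [codewords, Set.mem_ofPred_eq, wordPoly_zero, map_zero]
    exact Ideal.zero_mem _
  · intro h
    have h1 := congrFun h ⟨0, hn'⟩
    rw [if_pos rfl, Pi.zero_apply] at h1
    exact one_ne_zero (uv_mul_const_eq_zero (F := F) (a := 1) (by rw [h1, zero_mul]))
  · refine (pairDist_le_two_mul _ _ {⟨0, hn'⟩} fun i hi => ?_).trans (by simp)
    by_contra h
    rw [Finset.mem_singleton] at h
    simp [h] at hi

theorem codePairDist_typeB {p : ℕ} [Fact p.Prime] [CharP F p] {a₀ a₁ a₃ : F} (a₂ a₄ : F)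
    (ha₀ : a₀ ≠ 0) (ha₃ : a₃ ≠ 0) {Γ r k i : ℕ} (h₁ : a₀ ^ p ^ (r + 1 + k) = a₁) (hΓ : 1 ≤ Γ)
    (hΓp : Γ < p) (hlt : (p * (p ^ r - 1) + (Γ - 1)) * p ^ k < i)
    (hle : i ≤ (p * (p ^ r - 1) + Γ) * p ^ k) :
    codePairDist (codewords (typeB (2 * p ^ (r + 1 + k)) (elemR a₁ a₂ a₃ a₄) a₀
      (p ^ (r + 1 + k) + i))) = 2 * (Γ + 1) * p ^ r := by
  classical
  have hp : 0 < p := (Fact.out : p.Prime).pos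
  have hr : 0 < p ^ r := by positivity
  have hTN : (p * (p ^ r - 1) + Γ) * p ^ k < p ^ (r + 1 + k) := by
    rw [pow_add]
    refine Nat.mul_lt_mul_of_pos_right ?_ (by positivity)
    have h2 : p * (p ^ r - 1) + p = p ^ (r + 1) := by
      rw [← Nat.mul_succ, Nat.succ_eq_add_one, Nat.sub_add_cancel hr, pow_succ, mul_comm]
    omega
  set N := p ^ (r + 1 + k) with hNdef
  set T := (p * (p ^ r - 1) + Γ) * p ^ k with hT
  have hN0 : 0 < N := by positivity
  have hn : 2 * N ≠ 0 := by omega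
  have hN : (X ^ 2 - C a₀ : F[X]) ^ N = X ^ (2 * N) - C a₁ := X_sq_sub_C_pow h₁
  have hmem := mem_codewords_typeB_iff hn a₂ a₄ ha₃ hN (hle.trans hTN.le)
  refine codePairDist_eq ?_ ?_
  -- The minimal word comes from (x² - a₀)^T with T the largest admissible i; T < N keeps its degree
  -- below n.
  · set f : F[X] := expand F 2 ((X - C a₀) ^ T) with hf
    have hmonic : f.Monic := ((monic_X_sub_C a₀).pow T).expand two_pos
    have hfdeg : f.degree < ((2 * N : ℕ) : WithBot ℕ) := by
      rw [degree_eq_natDegree hmonic.ne_zero, hf, natDegree_expand, natDegree_pow,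
        natDegree_X_sub_C]
      exact_mod_cast (by omega : T * 1 * 2 < 2 * N)
    have hword := wordPoly_coeff hfdeg
    refine ⟨_, (hmem _).2 ⟨fun j => f.coeff j, ?_, rfl⟩, 0, ?_, ?_, ?_⟩
    · rw [hword, hf, ← X_sq_sub_C_pow_eq_expand]
      exact pow_dvd_pow _ hle
    · rw [codewords, Set.mem_ofPred_eq, wordPoly_zero, map_zero]
      exact Ideal.zero_mem _
    · intro h
      apply hmonic.ne_zero
      rw [← hword]
      convert wordPoly_zero with j
      exact uv_mul_const_eq_zero (congrFun h j)
    · refine (pairDist_le_two_mul _ _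
        (Finset.univ.filter fun j : Fin (2 * N) => f.coeff j ≠ 0 ∧ True) fun j hj => ?_).trans ?_
      · refine Finset.mem_filter.2 ⟨Finset.mem_univ _, fun h => hj ?_, trivial⟩
        simp [h, const]
      · rw [card_filter_wordPoly (fun j : Fin (2 * N) => f.coeff j) (fun _ => True), hword,
          Finset.filter_true, mul_assoc]
        refine Nat.mul_le_mul_left _ ((card_support_expand_le two_pos _).trans ?_)
        exact card_support_X_sub_C_pow_le a₀ Γ r k
  · intro x hx y hy hxy
    obtain ⟨g, hg, rfl⟩ := (hmem x).1 hx
    obtain ⟨g', hg', rfl⟩ := (hmem y).1 hy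
    have hdvd : (X ^ 2 - C a₀) ^ i ∣ wordPoly (g - g') := by
      rw [wordPoly_sub]
      exact dvd_sub hg hg'
    have hne : wordPoly (g - g') ≠ 0 := by
      intro h
      rw [← wordPoly_zero (n := 2 * N)] at h
      rw [sub_eq_zero.1 (wordPoly_injective h)] at hxy
      exact hxy rfl
    -- Work with one nonzero parity class: it inherits divisibility by (X - a₀)^i, and its positions
    -- are pairwise nonadjacent.
    obtain ⟨j, hj, hsect⟩ : ∃ j < 2, sect 2 j (wordPoly (g - g')) ≠ 0 := by
      by_contra! h
      apply hne
      rw [← sum_X_pow_mul_expand_sect two_pos (wordPoly (g - g'))]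
      refine Finset.sum_eq_zero fun j hj => ?_
      rw [h j (Finset.mem_range.1 hj), map_zero, mul_zero]
    have hsdvd : (X - C a₀) ^ i ∣ sect 2 j (wordPoly (g - g')) := by
      obtain ⟨q, hq⟩ := hdvd
      rw [hq, X_sq_sub_C_pow_eq_expand, sect_expand_mul hj]
      exact dvd_mul_right _ _
    have hsdeg : (sect 2 j (wordPoly (g - g'))).natDegree < N := by
      by_contra h
      have h1 := leadingCoeff_ne_zero.2 hsect
      rw [leadingCoeff, coeff_sect two_pos] at h1
      have h2 := (le_degree_of_ne_zero h1).trans_lt (degree_wordPoly_lt _)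
      have h3 := Nat.cast_lt.1 h2
      omega
    have hcard := le_card_support_of_dvd ha₀ hΓ hΓp hlt hsect hsdeg hsdvd
    rw [card_support_sect hj, ← card_filter_wordPoly] at hcard
    rw [mul_assoc]
    refine (Nat.mul_le_mul_left 2 hcard).trans (two_mul_le_pairDist _ _ _ ?_ ?_)
    · intro l hl h
      apply (Finset.mem_filter.1 hl).2.1
      apply uv_mul_const_eq_zero
      rw [Pi.sub_apply, const, map_sub, mul_sub]
      exact sub_eq_zero.2 h
    · intro l hl h
      apply val_finRotate_mod_two (even_two_mul N) l
      rw [(Finset.mem_filter.1 hl).2.2, (Finset.mem_filter.1 h).2.2]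

end SymbolPair

end

theorem theorem12 {F : Type*} [Field F] [Fintype F] (p m s : ℕ) (hp : p.Prime) (hp2 : p ≠ 2)
    (hm : 0 < m) (hs : 0 < s) (hF : Fintype.card F = p ^ m)
    (α₁ α₂ α₃ α₄ : F) (hα₁ : α₁ ≠ 0) (hα₃ : α₃ ≠ 0)
    (ℓ : ℕ) (hℓ : ℓ ≤ 2 * p ^ s - 1) :
    (ℓ ≤ p ^ s →
      SymbolPair.codePairDist (SymbolPair.codewords
        (SymbolPair.typeB (2 * p ^ s) (SymbolPair.elemR α₁ α₂ α₃ α₄)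
          (SymbolPair.alphaZero p m s α₁) ℓ)) = 2) ∧
    (∀ Γ γ : ℕ, 1 ≤ Γ → Γ ≤ p - 1 → γ ≤ s - 1 →
      2 * p ^ s - p ^ (s - γ) + (Γ - 1) * p ^ (s - γ - 1) + 1 ≤ ℓ →
      ℓ ≤ 2 * p ^ s - p ^ (s - γ) + Γ * p ^ (s - γ - 1) →
      SymbolPair.codePairDist (SymbolPair.codewords
        (SymbolPair.typeB (2 * p ^ s) (SymbolPair.elemR α₁ α₂ α₃ α₄)
          (SymbolPair.alphaZero p m s α₁) ℓ)) = 2 * (Γ + 1) * p ^ γ) := by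
  have : Fact p.Prime := ⟨hp⟩
  have : CharP F p := charP_of_card_eq_prime_pow hF
  have hpow := SymbolPair.alphaZero_pow (s := s) hm hF α₁
  have hps : 0 < p ^ s := pow_pos hp.pos s
  refine ⟨fun h => SymbolPair.codePairDist_typeB_of_le (by omega) (even_two_mul _) α₂ α₄ hα₃
    (SymbolPair.X_sq_sub_C_pow hpow) h, fun Γ γ hΓ hΓp hγ hlo hhi => ?_⟩
  obtain ⟨k, rfl⟩ : ∃ k, s = γ + 1 + k := ⟨s - γ - 1, by omega⟩
  have e1 : γ + 1 + k - γ = k + 1 := by omega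
  rw [e1, Nat.add_sub_cancel] at hlo hhi
  have e2 : p ^ (k + 1) ≤ p ^ (γ + 1 + k) := Nat.pow_le_pow_right hp.pos (by omega)
  have e3 : p * (p ^ γ - 1) * p ^ k = p ^ (γ + 1 + k) - p ^ (k + 1) := by
    rw [Nat.mul_sub, Nat.sub_mul]
    congr 1 <;> ring
  -- As p^(s-γ) ≤ p^s, the range forces ℓ ≥ p^s. Subtracting p^s leaves p^s - p^(k+1) = p(p^γ -
  -- 1)p^k in both bounds, the form used by the digit estimate.
  obtain ⟨i, rfl⟩ : ∃ i, ℓ = p ^ (γ + 1 + k) + i := ⟨ℓ - p ^ (γ + 1 + k), by omega⟩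
  refine SymbolPair.codePairDist_typeB α₂ α₄ (SymbolPair.alphaZero_ne_zero hα₁) hα₃ hpow hΓ
    (by have := hp.pos; omega) ?_ ?_
  · rw [add_mul, e3]
    omega
  · rw [add_mul, e3]
    omega
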